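/- Let $V$ be a finite-dimensional vector space over $\mathbb{F}_2$ with a bilinear form $\Omega : V \times V \to \mathbb{F}_2$ such that $\Omega(v,v)=0$ for all $v \in V$. For $v \in V$ let $\tau_v : V \to V$ be the symplectic transvection $\tau_v(x) = x - \Omega(x,v)\,v$. Let $B \subset V$ be a linearly independent subset, let $U$ be the linear span of $B$, let $\Gamma \subset GL(V)$ be the subgroup generated by the $\tau_b$ with $b \in B$, and let $V^\Gamma$ be the subspace of vectors fixed by $\Gamma$. Regard $B$ as the vertex set of the graph in which $\{b,b'\}$ is an edge if and only if $\Omega(b,b')=1$. Assume that this graph is $E_6$-compatible, that is, it is connected and contains an induced subgraph on $6$ vertices isomorphic to the Dynkin graph $E_6$. Then there exist functions $Q : V \to \mathbb{F}_2$ such that $$Q(u+v) = Q(u)+Q(v)+\Omega(u,v) \quad (u,v \in V), \qquad Q(b)=1 \quad (b \in B),$$ and for every $v \in V$ the following holds. The set $(v+U) \setminus V^\Gamma$ consists of precisely two $\Gamma$-orbits. For every function $Q$ with the above properties, these two orbits are the intersections of $(v+U) \setminus V^\Gamma$ with the level sets $Q^{-1}(0)$ and $Q^{-1}(1)$. -/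

import Mathlib

namespace TransvectionOrbits

/-- The Dynkin graph `E₆`: the path `0 - 1 - 2 - 3 - 4` with one further vertex `5`
joined to the middle vertex `2`. -/
def dynkinE6 : SimpleGraph (Fin 6) :=
  SimpleGraph.fromEdgeSet {s(0, 1), s(1, 2), s(2, 3), s(3, 4), s(2, 5)}

/-- A finite graph is `E₆`-compatible if it is connected and contains an induced subgraph
isomorphic to the Dynkin graph `E₆`. -/
def IsE6Compatible {W : Type*} (G : SimpleGraph W) : Prop :=
  Finite W ∧ G.Connected ∧ dynkinE6.IsIndContained G

variable {V : Type*} [AddCommGroup V] [Module (ZMod 2) V]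

/-- The graph with vertex set `B` in which `{b, b'}` is an edge whenever `Ω(b, b') = 1`. -/
def formGraph (Ω : LinearMap.BilinForm (ZMod 2) V) (hΩ : Ω.IsAlt) (B : Set V) :
    SimpleGraph B where
  Adj b b' := Ω (b : V) (b' : V) = 1
  symm := ⟨fun b b' h => by
    rw [← LinearMap.BilinForm.IsAlt.neg_eq hΩ, h]; decide⟩
  loopless := ⟨fun b h => by
    rw [hΩ (b : V)] at h; exact absurd h (by decide)⟩

/-- The symplectic transvection `τ_v(x) = x - Ω(x, v) v`, as an element of `GL(V)`. -/
def symplecticTransvection (Ω : LinearMap.BilinForm (ZMod 2) V) (hΩ : Ω.IsAlt) (v : V) :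
    V ≃ₗ[ZMod 2] V :=
  LinearEquiv.transvection (f := -(LinearMap.flip Ω v)) (v := v) (by simp [hΩ v])

theorem symplecticTransvection_apply (Ω : LinearMap.BilinForm (ZMod 2) V) (hΩ : Ω.IsAlt)
    (v x : V) : symplecticTransvection Ω hΩ v x = x - Ω x v • v := by
  change x + (-(LinearMap.flip Ω v)) x • v = _
  rw [sub_eq_add_neg, ← neg_smul]
  rfl

/-- The subgroup `Γ` of `GL(V)` generated by the transvections `τ_b` for `b ∈ B`. -/
def transvectionGroup (Ω : LinearMap.BilinForm (ZMod 2) V) (hΩ : Ω.IsAlt) (B : Set V) :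
    Subgroup (V ≃ₗ[ZMod 2] V) :=
  Subgroup.closure (symplecticTransvection Ω hΩ '' B)

/-- The properties required of the function `Q : V → 𝔽₂`: it is a quadratic function with
`Q(u + v) = Q(u) + Q(v) + Ω(u, v)`, and it takes the value `1` on `B`. -/
structure IsAdaptedQuadratic (Ω : LinearMap.BilinForm (ZMod 2) V) (B : Set V)
    (Q : V → ZMod 2) : Prop where
  map_add : ∀ u v : V, Q (u + v) = Q u + Q v + Ω u v
  map_basis : ∀ b ∈ B, Q b = 1

/-- The set `(v + U) \ V^Γ`, where `U` is the linear span of `B` and `V^Γ` is the set of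
vectors fixed by `Γ`. -/
def movedSlice (Ω : LinearMap.BilinForm (ZMod 2) V) (hΩ : Ω.IsAlt) (B : Set V) (v : V) :
    Set V :=
  {x | ∃ u ∈ Submodule.span (ZMod 2) B, x = v + u} \
    MulAction.fixedPoints (transvectionGroup Ω hΩ B) V

/-- The set of `Γ`-orbits of the elements of a subset `S` of `V`. -/
def orbitsOf (Γ : Subgroup (V ≃ₗ[ZMod 2] V)) (S : Set V) : Set (Set V) :=
  {O | ∃ x ∈ S, O = MulAction.orbit Γ x}

end TransvectionOrbits

namespace TransvectionOrbits

/-! Each `τ_b` preserves `Q` and the cosets of `U`, so only transitivity on the moved vectors with a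
given value of `Q` is at stake. The `E₆` form is nondegenerate mod 2, so `V` splits as the span of
an `E₆` frame plus its orthogonal complement. The frame transvections fix the second component and
act on the first, where transitivity on each level set of nonzero vectors is a finite check.

The general case grows the frame one adjacent vertex `b` at a time
(`IsSliceTransitive.insert_of_adj`). A slice for `insert b S` is the union of the slices for `S`
through `x` and `x + b`. `IsE6Frame.exists_bridge` finds `z` in the first with `Q z = Q x` and `τ_b
z = z + b`, both ends being moved by the frame. The `S`-orbits on the two sides are thereby joined.
Connectedness lets the growth reach all of `B`. -/

theorem zmod_two_eq_zero_or_one (c : ZMod 2) : c = 0 ∨ c = 1 := by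
  revert c; decide

/-! ### Coordinates on the six-dimensional form of type `E₆` over `𝔽₂` -/

/-- The pairings of the vector with coordinates `a` with the six basis vectors. -/
def e6Pairing (a : Fin 6 → ZMod 2) : Fin 6 → ZMod 2 :=
  ![a 1, a 0 + a 2, a 1 + a 3 + a 5, a 2 + a 4, a 3, a 2]

/-- The inverse of `e6Pairing`. -/
def e6Dual (t : Fin 6 → ZMod 2) : Fin 6 → ZMod 2 :=
  ![t 1 + t 5, t 0, t 5, t 4, t 3 + t 5, t 0 + t 2 + t 4]

/-- The quadratic form of type `E₆`, with value `1` on the basis vectors. -/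
def e6Quad (a : Fin 6 → ZMod 2) : ZMod 2 :=
  a 0 + a 1 + a 2 + a 3 + a 4 + a 5 +
    (a 0 * a 1 + a 1 * a 2 + a 2 * a 3 + a 3 * a 4 + a 2 * a 5)

/-- The transvection in the `i`-th basis vector. -/
def e6Reflect (i : Fin 6) (a : Fin 6 → ZMod 2) : Fin 6 → ZMod 2 :=
  a + Pi.single i (e6Pairing a i)

/-- A nonzero representative for each value of `e6Quad`. -/
def e6Rep (q : ZMod 2) : Fin 6 → ZMod 2 :=
  if q = 0 then ![0, 1, 0, 1, 0, 0] else ![1, 1, 1, 1, 1, 1]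

/-- The number of transvections in basis vectors needed to reach `e6Rep`: the hexadecimal digit
at the position whose binary digits are the coordinates. -/
def e6Depth (a : Fin 6 → ZMod 2) : ℕ :=
  0x152122754452336124323382354786512432134435432452334102534454550 /
    16 ^ ((a 0).val + 2 * (a 1).val + 4 * (a 2).val + 8 * (a 3).val + 16 * (a 4).val
      + 32 * (a 5).val) % 16

/-- The Cartan determinant of `E₆` is 3, which is odd, so the form mod 2 is invertible. -/
theorem e6Pairing_e6Dual (t : Fin 6 → ZMod 2) : e6Pairing (e6Dual t) = t := by
  revert t; decide +kernel

theorem e6Dual_e6Pairing (a : Fin 6 → ZMod 2) : e6Dual (e6Pairing a) = a := by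
  revert a; decide +kernel

/-- Checking 64 vectors yields transitivity on the nonzero vectors of each level set. Nonvanishing
and the value of the form are carried along so that the descent can be iterated. -/
theorem e6Reflect_descends (a : Fin 6 → ZMod 2) (ha : a ≠ 0) :
    a = e6Rep (e6Quad a) ∨ ∃ i, e6Depth (e6Reflect i a) < e6Depth a ∧ e6Reflect i a ≠ 0 ∧
      e6Quad (e6Reflect i a) = e6Quad a := by
  revert a; decide +kernel

theorem exists_e6Quad_eq (q : ZMod 2) : ∃ a, a ≠ 0 ∧ e6Quad a = q := by
  revert q; decide +kernel

/-- Supplies the bridge vector when `c` is the frame component of the new vertex. -/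
theorem exists_e6Quad_eq_of_ne_zero (c : Fin 6 → ZMod 2) (hc : c ≠ 0) (q p : ZMod 2) :
    ∃ a, a ≠ 0 ∧ a + c ≠ 0 ∧ e6Quad a = q ∧ ∑ i, c i * e6Pairing a i = p := by
  revert c; revert q p; decide +kernel

/-! ### Splitting off an `E₆` frame -/

section Frame

variable {V : Type*} [AddCommGroup V] [Module (ZMod 2) V]

/-- Six vectors whose pairings are the adjacencies of the Dynkin graph `E₆`. -/
def IsE6Frame (Ω : LinearMap.BilinForm (ZMod 2) V) (e : Fin 6 → V) : Prop :=
  ∀ (i : Fin 6) (a : Fin 6 → ZMod 2), Ω (∑ j, a j • e j) (e i) = e6Pairing a i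

theorem isE6Frame_of_adj {Ω : LinearMap.BilinForm (ZMod 2) V} {e : Fin 6 → V}
    (h : ∀ i j, Ω (e i) (e j) = 1 ↔ dynkinE6.Adj i j) : IsE6Frame Ω e := by
  have h1 : ∀ i j, dynkinE6.Adj i j → Ω (e i) (e j) = 1 := fun i j hij => (h i j).2 hij
  have h0 : ∀ i j, ¬ dynkinE6.Adj i j → Ω (e i) (e j) = 0 := fun i j hij => by
    rcases zmod_two_eq_zero_or_one (Ω (e i) (e j)) with h' | h'
    · exact h'
    · exact absurd ((h i j).1 h') hij
  intro i a
  simp only [Fin.sum_univ_six, map_add, map_smul, LinearMap.add_apply, LinearMap.smul_apply,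
    smul_eq_mul]
  -- Writing the Gram matrix through `e6Pairing` leaves an identity over `𝔽₂` that is decidable.
  have hv : ∀ i j, Ω (e i) (e j) = e6Pairing (Pi.single i 1) j := by
    intro i j
    by_cases hij : dynkinE6.Adj i j
    · rw [h1 i j hij]
      simp only [dynkinE6, SimpleGraph.fromEdgeSet_adj] at hij
      revert hij; revert i j; decide +kernel
    · rw [h0 i j hij]
      simp only [dynkinE6, SimpleGraph.fromEdgeSet_adj] at hij
      revert hij; revert i j; decide +kernel
  simp only [hv]
  revert i a; decide +kernel

theorem IsAdaptedQuadratic.map_smul {Ω : LinearMap.BilinForm (ZMod 2) V} {B : Set V}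
    {Q : V → ZMod 2} (hQ : IsAdaptedQuadratic Ω B Q) (c : ZMod 2) (v : V) :
    Q (c • v) = c * Q v := by
  have h0 : Q 0 = 0 := by simpa using hQ.map_add 0 0
  rcases zmod_two_eq_zero_or_one c with rfl | rfl
  · simp [h0]
  · simp

theorem IsAdaptedQuadratic.mono {Ω : LinearMap.BilinForm (ZMod 2) V} {B C : Set V}
    {Q : V → ZMod 2} (hQ : IsAdaptedQuadratic Ω B Q) (h : C ⊆ B) : IsAdaptedQuadratic Ω C Q :=
  ⟨hQ.map_add, fun b hb => hQ.map_basis b (h hb)⟩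

variable {Ω : LinearMap.BilinForm (ZMod 2) V} {Q : V → ZMod 2} {e : Fin 6 → V}

theorem IsE6Frame.quad_sum (he : IsE6Frame Ω e) (hQ : IsAdaptedQuadratic Ω (Set.range e) Q)
    (a : Fin 6 → ZMod 2) : Q (∑ i, a i • e i) = e6Quad a := by
  have hb : ∀ i j, Ω (e i) (e j) = e6Pairing (Pi.single i 1) j := by
    intro i j
    rw [← he j (Pi.single i 1)]
    simp [Pi.single_apply]
  have hq : ∀ i, Q (e i) = 1 := fun i => hQ.map_basis _ ⟨i, rfl⟩
  simp only [Fin.sum_univ_six, hQ.map_add, hQ.map_smul, hq, map_add, _root_.map_smul,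
    LinearMap.add_apply, LinearMap.smul_apply, smul_eq_mul, hb]
  revert a; decide +kernel

/-- Every vector differs from one orthogonal to the frame by a combination of the frame. -/
theorem IsE6Frame.exists_decomposition (he : IsE6Frame Ω e) (x : V) :
    ∃ (x₀ : V) (a : Fin 6 → ZMod 2), (∀ i, Ω x₀ (e i) = 0) ∧ x = x₀ + ∑ i, a i • e i := by
  refine ⟨x - ∑ i, e6Dual (fun i => Ω x (e i)) i • e i, e6Dual (fun i => Ω x (e i)), ?_, by simp⟩
  intro i
  rw [map_sub, LinearMap.sub_apply, he, e6Pairing_e6Dual, sub_self]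

theorem e6Pairing_eq_zero_iff {a : Fin 6 → ZMod 2} : e6Pairing a = 0 ↔ a = 0 := by
  constructor
  · intro h
    rw [← e6Dual_e6Pairing a, h]
    decide
  · rintro rfl
    decide

theorem IsE6Frame.exists_pairing_ne_zero_iff (he : IsE6Frame Ω e) {x₀ : V}
    (hx₀ : ∀ i, Ω x₀ (e i) = 0) (a : Fin 6 → ZMod 2) :
    (∃ i, Ω (x₀ + ∑ j, a j • e j) (e i) ≠ 0) ↔ a ≠ 0 := by
  simp only [map_add, LinearMap.add_apply, hx₀, he _, zero_add]
  exact (Function.ne_iff (f₁ := e6Pairing a) (f₂ := 0)).symm.trans (not_congr e6Pairing_eq_zero_iff)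

theorem orthogonal_sum (hΩ : Ω.IsAlt) {x₀ : V} (hx₀ : ∀ i, Ω x₀ (e i) = 0) (a : Fin 6 → ZMod 2) :
    Ω x₀ (∑ j, a j • e j) = 0 ∧ Ω (∑ j, a j • e j) x₀ = 0 := by
  have h : Ω x₀ (∑ j, a j • e j) = 0 := by simp [map_sum, hx₀]
  exact ⟨h, hΩ.isRefl _ _ h⟩

/-- The slice through `x` contains a vector with the same value of `Q` which pairs to `1` with `b`,
and which pairs nontrivially with the frame, both before and after adding `b`. -/
theorem IsE6Frame.exists_bridge (hΩ : Ω.IsAlt) (he : IsE6Frame Ω e)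
    (hQ : IsAdaptedQuadratic Ω (Set.range e) Q) {b s : V} (hs : Ω s b = 1) (x : V) :
    ∃ z, z - x ∈ Submodule.span (ZMod 2) (insert s (Set.range e)) ∧ Q z = Q x ∧ Ω z b = 1 ∧
      (∃ i, Ω z (e i) ≠ 0) ∧ ∃ i, Ω (z + b) (e i) ≠ 0 := by
  have hmem : ∀ a : Fin 6 → ZMod 2, ∑ i, a i • e i ∈
      Submodule.span (ZMod 2) (insert s (Set.range e)) := fun a =>
    Submodule.sum_mem _ fun i _ => Submodule.smul_mem _ _ (Submodule.subset_span (by simp))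
  have hsm : s ∈ Submodule.span (ZMod 2) (insert s (Set.range e)) :=
    Submodule.subset_span (by simp)
  obtain ⟨b₀, c, hb₀, hbc⟩ := he.exists_decomposition b
  have hsum : ∀ {y₀ : V}, (∀ i, Ω y₀ (e i) = 0) → ∀ a,
      Q (y₀ + ∑ i, a i • e i) = Q y₀ + e6Quad a := by
    intro y₀ hy₀ a
    rw [hQ.map_add, (orthogonal_sum hΩ hy₀ a).1, he.quad_sum hQ, add_zero]
  have hadd : ∀ (y₀ : V) (a : Fin 6 → ZMod 2), y₀ + ∑ i, a i • e i + b =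
      (y₀ + b₀) + ∑ i, (a + c) i • e i := by
    intro y₀ a
    simp only [Pi.add_apply, add_smul, Finset.sum_add_distrib]
    rw [hbc]; abel
  have hperp : ∀ {y₀ : V}, (∀ i, Ω y₀ (e i) = 0) → ∀ i, Ω (y₀ + b₀) (e i) = 0 := by
    intro y₀ hy₀ i
    simp [hy₀ i, hb₀ i]
  by_cases hc : c = 0
  -- Here `b` is orthogonal to the frame: a multiple of `s` corrects the pairing with `b`, and the
  -- frame coordinates then adjust `Q` without disturbing it.
  · obtain ⟨t, ht⟩ : ∃ t : ZMod 2, Ω (x + t • s) b = 1 := by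
      refine ⟨1 - Ω x b, ?_⟩
      simp [hs]
    obtain ⟨y₀, d, hy₀, hyd⟩ := he.exists_decomposition (x + t • s)
    obtain ⟨a, ha, haq⟩ := exists_e6Quad_eq (Q x - Q y₀)
    have hbe : b = b₀ := by simpa [hc] using hbc
    refine ⟨y₀ + ∑ i, a i • e i, ?_, ?_, ?_, ?_, ?_⟩
    · rw [show y₀ + ∑ i, a i • e i - x = t • s + ∑ i, a i • e i - ∑ i, d i • e i by
        rw [show y₀ = x + t • s - ∑ i, d i • e i by rw [hyd]; abel]; abel]
      exact Submodule.sub_mem _ (Submodule.add_mem _ (Submodule.smul_mem _ _ hsm) (hmem _)) (hmem _)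
    · rw [hsum hy₀, haq]; ring
    · rw [hyd, hbe, map_add, LinearMap.add_apply, (orthogonal_sum hΩ hb₀ _).2] at ht
      rw [hbe, map_add, LinearMap.add_apply, (orthogonal_sum hΩ hb₀ _).2, ht]
    · exact (he.exists_pairing_ne_zero_iff hy₀ a).2 ha
    · rw [hadd]
      exact (he.exists_pairing_ne_zero_iff (hperp hy₀) _).2 (by simpa [hc] using ha)
  -- Here the frame alone suffices. The pairing with `b` is `Ω y₀ b₀` plus the pairing of `a` with
  -- `c`, hence the target `1 - Ω y₀ b₀`.
  · obtain ⟨y₀, d, hy₀, hyd⟩ := he.exists_decomposition x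
    obtain ⟨a, ha, hac, haq, hap⟩ := exists_e6Quad_eq_of_ne_zero c hc (e6Quad d) (1 - Ω y₀ b₀)
    refine ⟨y₀ + ∑ i, a i • e i, ?_, ?_, ?_, ?_, ?_⟩
    · rw [show y₀ + ∑ i, a i • e i - x = ∑ i, a i • e i - ∑ i, d i • e i by rw [hyd]; abel]
      exact Submodule.sub_mem _ (hmem _) (hmem _)
    · rw [hyd, hsum hy₀, hsum hy₀, haq]
    · have h1 : Ω (∑ i, a i • e i) (∑ i, c i • e i) = ∑ i, c i * e6Pairing a i := by
        rw [map_sum]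
        exact Finset.sum_congr rfl fun i _ => by rw [_root_.map_smul, he, smul_eq_mul]
      rw [hbc]
      simp only [map_add, LinearMap.add_apply] at h1 ⊢
      rw [h1, hap, (orthogonal_sum hΩ hy₀ c).1, (orthogonal_sum hΩ hb₀ a).2]
      ring
    · exact (he.exists_pairing_ne_zero_iff hy₀ a).2 ha
    · rw [hadd]
      exact (he.exists_pairing_ne_zero_iff (hperp hy₀) _).2 hac

end Frame

/-! ### Transitivity on slices -/

section Transitivity

variable {V : Type*} [AddCommGroup V] [Module (ZMod 2) V]
  {Ω : LinearMap.BilinForm (ZMod 2) V} {hΩ : Ω.IsAlt} {Q : V → ZMod 2}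

theorem add_self_eq_zero_of_zmod_two (v : V) : v + v = 0 := by
  rw [← two_smul (ZMod 2) v, show (2 : ZMod 2) = 0 from rfl, zero_smul]

theorem symplecticTransvection_mem {B : Set V} {b : V} (hb : b ∈ B) :
    symplecticTransvection Ω hΩ b ∈ transvectionGroup Ω hΩ B :=
  Subgroup.subset_closure ⟨b, hb, rfl⟩

theorem transvectionGroup_mono {B C : Set V} (h : B ⊆ C) :
    transvectionGroup Ω hΩ B ≤ transvectionGroup Ω hΩ C :=
  Subgroup.closure_mono (Set.image_mono h)

theorem symplecticTransvection_apply_of_eq_one {b x : V} (h : Ω x b = 1) :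
    symplecticTransvection Ω hΩ b x = x + b := by
  rw [symplecticTransvection_apply, h, one_smul, sub_eq_add_neg,
    neg_eq_of_add_eq_zero_left (add_self_eq_zero_of_zmod_two b)]

theorem mem_fixedPoints_iff (B : Set V) (x : V) :
    x ∈ MulAction.fixedPoints (transvectionGroup Ω hΩ B) V ↔ ∀ b ∈ B, Ω x b = 0 := by
  constructor
  · intro h b hb
    rcases zmod_two_eq_zero_or_one (Ω x b) with h' | h'
    · exact h'
    · have h1 : symplecticTransvection Ω hΩ b x = x := h ⟨_, symplecticTransvection_mem hb⟩
      rw [symplecticTransvection_apply_of_eq_one h'] at h1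
      -- From `x + b = x` follows `b = 0`, so the pairing vanishes after all.
      rw [left_eq_add.1 h1.symm] at h' ⊢
      exact map_zero _
  · rintro h ⟨g, hg⟩
    change g x = x
    have hle : transvectionGroup Ω hΩ B ≤ MulAction.stabilizer (V ≃ₗ[ZMod 2] V) x := by
      refine (Subgroup.closure_le _).2 ?_
      rintro _ ⟨b, hb, rfl⟩
      change symplecticTransvection Ω hΩ b x = x
      rw [symplecticTransvection_apply, h b hb, zero_smul, sub_zero]
    exact hle hg

theorem map_symplecticTransvection {B : Set V} (hQ : IsAdaptedQuadratic Ω B Q) {b : V}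
    (hb : b ∈ B) (x : V) : Q (symplecticTransvection Ω hΩ b x) = Q x := by
  rcases zmod_two_eq_zero_or_one (Ω x b) with h | h
  · rw [symplecticTransvection_apply, h, zero_smul, sub_zero]
  · rw [symplecticTransvection_apply_of_eq_one h, hQ.map_add, hQ.map_basis b hb, h, add_assoc]
    exact add_eq_left.2 (by decide)

theorem transvectionGroup_preserves {B : Set V} (hQ : IsAdaptedQuadratic Ω B Q)
    {g : V ≃ₗ[ZMod 2] V} (hg : g ∈ transvectionGroup Ω hΩ B) (x : V) :
    Q (g x) = Q x ∧ g x - x ∈ Submodule.span (ZMod 2) B := by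
  induction hg using Subgroup.closure_induction generalizing x with
  | mem g hg =>
    obtain ⟨b, hb, rfl⟩ := hg
    refine ⟨map_symplecticTransvection hQ hb x, ?_⟩
    rw [symplecticTransvection_apply, sub_sub_cancel_left]
    exact Submodule.neg_mem _ (Submodule.smul_mem _ _ (Submodule.subset_span hb))
  | one => simp
  | mul g h _ _ ihg ihh =>
    obtain ⟨h1, h2⟩ := ihg (h x)
    obtain ⟨h3, h4⟩ := ihh x
    refine ⟨h1.trans h3, ?_⟩
    simpa using Submodule.add_mem _ h2 h4
  | inv g _ ih =>
    obtain ⟨h1, h2⟩ := ih (g⁻¹ x)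
    have hgx : g (g⁻¹ x) = x := g.apply_symm_apply x
    rw [hgx] at h1 h2
    exact ⟨h1.symm, by simpa using Submodule.neg_mem _ h2⟩

/-- Any two vectors of a slice that are moved by some `τ_s` with `s ∈ S` and have the same value
of `Q` lie in one orbit of the group generated by the `τ_s`. -/
def IsSliceTransitive (Ω : LinearMap.BilinForm (ZMod 2) V) (hΩ : Ω.IsAlt) (Q : V → ZMod 2)
    (S : Set V) : Prop :=
  ∀ x y, y - x ∈ Submodule.span (ZMod 2) S → Q x = Q y → (∃ s ∈ S, Ω x s ≠ 0) →
    (∃ s ∈ S, Ω y s ≠ 0) → ∃ g ∈ transvectionGroup Ω hΩ S, g x = y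

/-- The frame transvections leave `x₀` alone and act on the coordinates by `e6Reflect`, so induction
on `e6Depth` applies. -/
theorem IsE6Frame.exists_map_eq_rep {e : Fin 6 → V} (he : IsE6Frame Ω e) {x₀ : V}
    (hx₀ : ∀ i, Ω x₀ (e i) = 0) (a : Fin 6 → ZMod 2) (ha : a ≠ 0) :
    ∃ g ∈ transvectionGroup Ω hΩ (Set.range e),
      g (x₀ + ∑ i, a i • e i) = x₀ + ∑ i, e6Rep (e6Quad a) i • e i := by
  induction hn : e6Depth a using Nat.strong_induction_on generalizing a with
  | _ n ih =>
    rcases e6Reflect_descends a ha with h | ⟨i, hi, hne, hq⟩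
    · exact ⟨1, one_mem _, by rw [← h]; rfl⟩
    · obtain ⟨g, hg, hga⟩ := ih _ (hn ▸ hi) _ hne rfl
      refine ⟨g * symplecticTransvection Ω hΩ (e i),
        mul_mem hg (symplecticTransvection_mem ⟨i, rfl⟩), ?_⟩
      rw [← hq, ← hga]
      change g _ = g _
      refine congrArg g ((symplecticTransvection_apply Ω hΩ (e i) _).trans ?_)
      rw [map_add, LinearMap.add_apply, hx₀, he, zero_add,
        sub_eq_add_neg, neg_eq_of_add_eq_zero_left (add_self_eq_zero_of_zmod_two _), add_assoc]
      simp [e6Reflect, add_smul, Finset.sum_add_distrib, Pi.single_apply]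

theorem IsE6Frame.isSliceTransitive {e : Fin 6 → V} (he : IsE6Frame Ω e)
    (hQ : IsAdaptedQuadratic Ω (Set.range e) Q) : IsSliceTransitive Ω hΩ Q (Set.range e) := by
  intro x y hxy hq hx hy
  simp only [Set.exists_range_iff] at hx hy
  obtain ⟨x₀, a, hx₀, rfl⟩ := he.exists_decomposition x
  obtain ⟨d, hd⟩ := (Submodule.mem_span_range_iff_exists_fun (ZMod 2)).1 hxy
  obtain rfl : y = x₀ + ∑ i, (a + d) i • e i := by
    simp only [Pi.add_apply, add_smul, Finset.sum_add_distrib, hd]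
    abel
  rw [he.exists_pairing_ne_zero_iff hx₀] at hx hy
  rw [hQ.map_add, hQ.map_add, (orthogonal_sum hΩ hx₀ _).1, (orthogonal_sum hΩ hx₀ _).1,
    he.quad_sum hQ, he.quad_sum hQ, add_left_inj, add_right_inj] at hq
  obtain ⟨g, hg, hgx⟩ := he.exists_map_eq_rep (hΩ := hΩ) hx₀ a hx
  obtain ⟨g', hg', hgy⟩ := he.exists_map_eq_rep (hΩ := hΩ) hx₀ _ hy
  refine ⟨g'⁻¹ * g, mul_mem (inv_mem hg') hg, ?_⟩
  change g'⁻¹ (g _) = _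
  rw [hgx, hq, ← hgy]
  exact g'.symm_apply_apply _

/-- Slice transitivity passes from `S` to `insert b S` when `b` is adjacent to `S`. -/
theorem IsSliceTransitive.insert_of_adj {e : Fin 6 → V} (he : IsE6Frame Ω e) {S : Set V}
    (heS : Set.range e ⊆ S) {b s : V} (hs : s ∈ S) (hsb : Ω s b = 1)
    (hQ : IsAdaptedQuadratic Ω (insert b S) Q) (hS : IsSliceTransitive Ω hΩ Q S) :
    IsSliceTransitive Ω hΩ Q (insert b S) := by
  have hle := transvectionGroup_mono (Ω := Ω) (hΩ := hΩ) (Set.subset_insert b S)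
  have hb := symplecticTransvection_mem (Ω := Ω) (hΩ := hΩ) (Set.mem_insert b S)
  have hbs : Ω b s = 1 := by
    rw [← LinearMap.BilinForm.IsAlt.neg_eq hΩ, hsb]; decide
  have hmove : ∀ x, (∃ s ∈ insert b S, Ω x s ≠ 0) →
      ∃ g ∈ transvectionGroup Ω hΩ (insert b S), ∃ s ∈ S, Ω (g x) s ≠ 0 := by
    intro x hx
    by_cases h : ∃ s ∈ S, Ω x s ≠ 0
    · exact ⟨1, one_mem _, h⟩
    · push Not at h
      obtain ⟨t, rfl | ht, htx⟩ := hx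
      -- A vector moved only by `τ_b` goes to `x + b`, which pairs to `1` with `s`.
      · refine ⟨_, hb, s, hs, ?_⟩
        rw [symplecticTransvection_apply_of_eq_one ((zmod_two_eq_zero_or_one _).resolve_left htx),
          map_add, LinearMap.add_apply, h s hs, hbs]
        decide
      · exact absurd (h t ht) htx
  have hmain : ∀ x y, y - x ∈ Submodule.span (ZMod 2) (insert b S) → Q x = Q y →
      (∃ s ∈ S, Ω x s ≠ 0) → (∃ s ∈ S, Ω y s ≠ 0) →
      ∃ g ∈ transvectionGroup Ω hΩ (insert b S), g x = y := by
    intro x y hxy hq hx hy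
    obtain ⟨c, u, hu, hcu⟩ := Submodule.mem_span_insert.1 hxy
    rcases zmod_two_eq_zero_or_one c with rfl | rfl
    · obtain ⟨g, hg, h⟩ := hS x y (by rw [hcu]; simpa using hu) hq hx hy
      exact ⟨g, hle hg, h⟩
    -- The two vectors lie in different cosets of the span of `S`: go from `x` to `z`, cross by
    -- `τ_b`, then go from `z + b` to `y`.
    · have hQe : IsAdaptedQuadratic Ω (Set.range e) Q :=
        hQ.mono (heS.trans (Set.subset_insert b S))
      obtain ⟨z, hzx, hzq, hzb, ⟨i, hi⟩, j, hj⟩ := he.exists_bridge hΩ hQe hsb x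
      replace hzx : z - x ∈ Submodule.span (ZMod 2) S :=
        Submodule.span_mono (Set.insert_subset hs heS) hzx
      obtain ⟨g, hg, hgx⟩ := hS x z hzx hzq.symm hx ⟨_, heS ⟨i, rfl⟩, hi⟩
      have hτ := symplecticTransvection_apply_of_eq_one (hΩ := hΩ) hzb
      have hqz : Q (z + b) = Q y := by
        rw [← hτ, map_symplecticTransvection hQ (Set.mem_insert b S), hzq, hq]
      have hyz : y - (z + b) ∈ Submodule.span (ZMod 2) S := by
        rw [show y - (z + b) = u - (z - x) by
          rw [show y = x + (y - x) by abel, hcu, one_smul]; abel]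
        exact Submodule.sub_mem _ hu hzx
      obtain ⟨g', hg', hgz⟩ := hS (z + b) y hyz hqz ⟨_, heS ⟨j, rfl⟩, hj⟩ hy
      refine ⟨g' * (symplecticTransvection Ω hΩ b * g), mul_mem (hle hg') (mul_mem hb (hle hg)), ?_⟩
      change g' (symplecticTransvection Ω hΩ b (g x)) = y
      rw [hgx, hτ, hgz]
  intro x y hxy hq hx hy
  obtain ⟨g, hg, hgx⟩ := hmove x hx
  obtain ⟨g', hg', hgy⟩ := hmove y hy
  obtain ⟨hq1, hd1⟩ := transvectionGroup_preserves hQ hg x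
  obtain ⟨hq2, hd2⟩ := transvectionGroup_preserves hQ hg' y
  obtain ⟨k, hk, hkx⟩ := hmain (g x) (g' y)
    (by
      rw [show g' y - g x = (g' y - y) + (y - x) - (g x - x) by abel]
      exact Submodule.sub_mem _ (Submodule.add_mem _ hd2 hxy) hd1)
    (by rw [hq1, hq2, hq]) hgx hgy
  refine ⟨g'⁻¹ * (k * g), mul_mem (inv_mem hg') (mul_mem hk hg), ?_⟩
  change g'⁻¹ (k (g x)) = y
  rw [hkx]
  exact g'.symm_apply_apply y

/-- A form whose graph on `B` is connected and contains a frame of type `E₆` is slice transitive. -/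
theorem isSliceTransitive_of_connected {e : Fin 6 → V} (he : IsE6Frame Ω e) {B : Set V}
    (hB : B.Finite) (heB : Set.range e ⊆ B) (hconn : (formGraph Ω hΩ B).Connected)
    (hQ : IsAdaptedQuadratic Ω B Q) : IsSliceTransitive Ω hΩ Q B := by
  have hfin : {S | S ⊆ B ∧ Set.range e ⊆ S ∧ IsSliceTransitive Ω hΩ Q S}.Finite :=
    hB.finite_subsets.subset fun S hS => hS.1
  obtain ⟨S, hS⟩ := hfin.exists_maximal
    ⟨_, heB, subset_rfl, he.isSliceTransitive (hQ.mono heB)⟩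
  obtain ⟨⟨hSB, heS, htr⟩, hmax⟩ := hS
  obtain rfl | hne := eq_or_ne S B
  · exact htr
  obtain ⟨c, hcB, hcS⟩ := Set.exists_of_ssubset (hSB.ssubset_of_ne hne)
  obtain ⟨p⟩ := hconn.preconnected ⟨e 0, heB ⟨0, rfl⟩⟩ ⟨c, hcB⟩
  -- A walk from the frame to a missing vertex leaves `S` along some edge; its outer end enlarges
  -- the maximal `S`.
  obtain ⟨d, -, hd1, hd2⟩ := p.exists_boundary_dart {w | (w : V) ∈ S} (heS ⟨0, rfl⟩) hcS
  have hins : insert (d.snd : V) S ⊆ B := Set.insert_subset d.snd.2 hSB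
  exact absurd (hmax ⟨hins, heS.trans (Set.subset_insert _ _),
    htr.insert_of_adj he heS hd1 d.adj (hQ.mono hins)⟩ (Set.subset_insert _ _) (Set.mem_insert _ _)) hd2

end Transitivity

/-! ### Existence of `Q` and the two orbits -/

section Orbits

variable {V : Type*} [AddCommGroup V] [Module (ZMod 2) V]

/-- A quadratic function with given polar form and given values on a linearly independent set. -/
theorem exists_isAdaptedQuadratic (Ω : LinearMap.BilinForm (ZMod 2) V) (hΩ : Ω.IsAlt) (B : Set V)
    (hB : LinearIndepOn (ZMod 2) id B) : ∃ Q, IsAdaptedQuadratic Ω B Q := by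
  classical
  let β := Module.Basis.extend hB
  let _ : LinearOrder (hB.extend (Set.subset_univ B)) := linearOrderOfSTO WellOrderingRel
  -- `T` is the strictly upper triangular part of `Ω`, so `v ↦ T v v` has polar form `Ω` and
  -- vanishes on the basis; adding `ℓ` makes the basis values `1`.
  let T : LinearMap.BilinForm (ZMod 2) V :=
    β.constr (ZMod 2) fun i => β.constr (ZMod 2) fun j => if i < j then Ω (β i) (β j) else 0
  have hT : ∀ i j, T (β i) (β j) = if i < j then Ω (β i) (β j) else 0 := by
    intro i j
    simp only [T, Module.Basis.constr_basis]
  let ℓ : V →ₗ[ZMod 2] ZMod 2 := β.constr (ZMod 2) fun _ => 1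
  have hflip : T + T.flip = Ω := by
    refine β.ext fun i => β.ext fun j => ?_
    simp only [LinearMap.add_apply, LinearMap.BilinForm.flip_apply, hT]
    rcases lt_trichotomy i j with h | rfl | h
    · simp [h, h.not_gt]
    · simp [hΩ (β i)]
    · rw [if_neg h.not_gt, if_pos h, zero_add, ← LinearMap.BilinForm.IsAlt.neg_eq hΩ,
        ZMod.neg_eq_self_mod_two]
  refine ⟨fun v => T v v + ℓ v, fun u v => ?_, fun b hb => ?_⟩
  · rw [← hflip]
    simp only [map_add, LinearMap.add_apply, LinearMap.BilinForm.flip_apply]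
    ring
  · have hbβ : β ⟨b, hB.subset_extend _ hb⟩ = b := Module.Basis.extend_apply_self hB _
    rw [← hbβ, hT]
    simp [ℓ]

variable {Ω : LinearMap.BilinForm (ZMod 2) V} {hΩ : Ω.IsAlt} {Q : V → ZMod 2} {B : Set V}

theorem mem_movedSlice_iff {v x : V} : x ∈ movedSlice Ω hΩ B v ↔
    x - v ∈ Submodule.span (ZMod 2) B ∧ ∃ b ∈ B, Ω x b ≠ 0 := by
  rw [movedSlice, Set.mem_sdiff, mem_fixedPoints_iff]
  push Not
  refine and_congr_left fun _ => ⟨?_, fun h => ⟨_, h, by abel⟩⟩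
  rintro ⟨u, hu, rfl⟩
  simpa using hu

theorem IsSliceTransitive.orbit_eq (htr : IsSliceTransitive Ω hΩ Q B)
    (hQ : IsAdaptedQuadratic Ω B Q) {v x : V} (hx : x ∈ movedSlice Ω hΩ B v) :
    MulAction.orbit (transvectionGroup Ω hΩ B) x = movedSlice Ω hΩ B v ∩ Q ⁻¹' {Q x} := by
  have hx' := mem_movedSlice_iff.1 hx
  ext y
  constructor
  · rintro ⟨⟨g, hg⟩, rfl⟩
    change g x ∈ _
    obtain ⟨h1, h2⟩ := transvectionGroup_preserves hQ hg x
    refine ⟨⟨?_, fun hfix => hx.2 ?_⟩, h1⟩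
    · refine ⟨(g x - x) + (x - v), Submodule.add_mem _ h2 hx'.1, by abel⟩
    -- If `g x` were fixed by the group, applying `g⁻¹` would give `x = g x`, so `x` would be fixed
    -- too.
    · have hgx : g⁻¹ (g x) = g x := hfix ⟨g⁻¹, inv_mem hg⟩
      rwa [← hgx, show g⁻¹ (g x) = x from g.symm_apply_apply x] at hfix
  · rintro ⟨hy, hyq⟩
    have hy' := mem_movedSlice_iff.1 hy
    obtain ⟨g, hg, hgx⟩ := htr x y
      (by simpa using Submodule.sub_mem _ hy'.1 hx'.1) (Eq.symm hyq) hx'.2 hy'.2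
    exact ⟨⟨g, hg⟩, hgx⟩

theorem IsE6Frame.exists_mem_movedSlice {e : Fin 6 → V} (he : IsE6Frame Ω e)
    (heB : Set.range e ⊆ B) (hQ : IsAdaptedQuadratic Ω B Q) (v : V) (q : ZMod 2) :
    ∃ x ∈ movedSlice Ω hΩ B v, Q x = q := by
  obtain ⟨x₀, d, hx₀, hd⟩ := he.exists_decomposition v
  obtain ⟨a, ha, haq⟩ := exists_e6Quad_eq (q - Q x₀)
  have hmem : ∀ a : Fin 6 → ZMod 2, ∑ i, a i • e i ∈ Submodule.span (ZMod 2) B := fun a =>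
    Submodule.sum_mem _ fun i _ => Submodule.smul_mem _ _ (Submodule.subset_span (heB ⟨i, rfl⟩))
  refine ⟨x₀ + ∑ i, a i • e i, mem_movedSlice_iff.2 ⟨?_, ?_⟩, ?_⟩
  · rw [show x₀ + ∑ i, a i • e i - v = ∑ i, a i • e i - ∑ i, d i • e i by rw [hd]; abel]
    exact Submodule.sub_mem _ (hmem a) (hmem d)
  · obtain ⟨i, hi⟩ := (he.exists_pairing_ne_zero_iff hx₀ a).2 ha
    exact ⟨e i, heB ⟨i, rfl⟩, hi⟩
  · rw [hQ.map_add, (orthogonal_sum hΩ hx₀ a).1, he.quad_sum (hQ.mono heB), haq]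
    ring

theorem IsE6Compatible.exists_frame (h : IsE6Compatible (formGraph Ω hΩ B)) :
    ∃ e : Fin 6 → V, IsE6Frame Ω e ∧ Set.range e ⊆ B := by
  obtain ⟨-, -, ⟨f⟩⟩ := h
  refine ⟨fun i => f i, isE6Frame_of_adj fun i j => f.map_rel_iff, ?_⟩
  rintro _ ⟨i, rfl⟩
  exact (f i).2

end Orbits

end TransvectionOrbits

theorem theorem6p2 {V : Type*} [AddCommGroup V] [Module (ZMod 2) V]
    [FiniteDimensional (ZMod 2) V]
    (Ω : LinearMap.BilinForm (ZMod 2) V) (hΩ : Ω.IsAlt)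
    (B : Set V) (hB : LinearIndepOn (ZMod 2) id B)
    (hE6 : TransvectionOrbits.IsE6Compatible (TransvectionOrbits.formGraph Ω hΩ B)) :
    (∃ Q : V → ZMod 2, TransvectionOrbits.IsAdaptedQuadratic Ω B Q) ∧
    ∀ v : V,
      (TransvectionOrbits.orbitsOf (TransvectionOrbits.transvectionGroup Ω hΩ B)
        (TransvectionOrbits.movedSlice Ω hΩ B v)).ncard = 2 ∧
      ∀ Q : V → ZMod 2, TransvectionOrbits.IsAdaptedQuadratic Ω B Q →
        TransvectionOrbits.orbitsOf (TransvectionOrbits.transvectionGroup Ω hΩ B)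
            (TransvectionOrbits.movedSlice Ω hΩ B v) =
          {TransvectionOrbits.movedSlice Ω hΩ B v ∩ Q ⁻¹' {0},
            TransvectionOrbits.movedSlice Ω hΩ B v ∩ Q ⁻¹' {1}} := by
  open TransvectionOrbits in
  obtain ⟨e, he, heB⟩ := hE6.exists_frame
  have hfin : B.Finite := Set.finite_coe_iff.1 hE6.1
  have horb : ∀ v (Q : V → ZMod 2), IsAdaptedQuadratic Ω B Q →
      orbitsOf (transvectionGroup Ω hΩ B) (movedSlice Ω hΩ B v) =
        {movedSlice Ω hΩ B v ∩ Q ⁻¹' {0}, movedSlice Ω hΩ B v ∩ Q ⁻¹' {1}} := by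
    intro v Q hQ
    have htr := isSliceTransitive_of_connected he hfin heB hE6.2.1 hQ
    ext O
    constructor
    · rintro ⟨x, hx, rfl⟩
      rw [htr.orbit_eq hQ hx]
      rcases zmod_two_eq_zero_or_one (Q x) with h | h <;> simp [h]
    · rintro (rfl | rfl)
      · obtain ⟨x, hx, hq⟩ := he.exists_mem_movedSlice (hΩ := hΩ) heB hQ v 0
        exact ⟨x, hx, by rw [htr.orbit_eq hQ hx, hq]⟩
      · obtain ⟨x, hx, hq⟩ := he.exists_mem_movedSlice (hΩ := hΩ) heB hQ v 1
        exact ⟨x, hx, by rw [htr.orbit_eq hQ hx, hq]⟩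
  obtain ⟨Q, hQ⟩ := exists_isAdaptedQuadratic Ω hΩ B hB
  refine ⟨⟨Q, hQ⟩, fun v => ⟨?_, fun Q hQ => horb v Q hQ⟩⟩
  rw [horb v Q hQ, Set.ncard_pair]
  intro heq
  obtain ⟨x, hx, hq⟩ := he.exists_mem_movedSlice (hΩ := hΩ) heB hQ v 0
  have h1 : x ∈ movedSlice Ω hΩ B v ∩ Q ⁻¹' {1} := heq ▸ ⟨hx, hq⟩
  exact zero_ne_one (hq.symm.trans h1.2)
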